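/- Let $k$ be a commutative ring. A (non-commutative) space $X$ is a $k$-linear Grothendieck category ${\sf Mod}X$, whose objects are called $X$-modules. $X$ is *integral* if ${\sf Mod}X$ has a set of noetherian generators and a *big injective*, i.e. an indecomposable injective ${\cal E}_X$ such that $\operatorname{End}{\cal E}_X$ is a division ring and every $X$-module is a subquotient of a direct sum of copies of ${\cal E}_X$. The *function field* of $X$ is the $k$-algebra $k(X)=\operatorname{End}{\cal E}_X$. A *weakly closed subspace* $W$ of $X$ is a full subcategory ${\sf Mod}W\subset{\sf Mod}X$ closed under subquotients and isomorphisms whose inclusion functor has a right adjoint. A *weakly open subspace* $U$ of $X$ is a full subcategory ${\sf Mod}U\subset{\sf Mod}X$ whose inclusion functor has an exact left adjoint. Its *weak closure* $\overline U$ is the smallest weakly closed subspace with ${\sf Mod}U\subset{\sf Mod}\overline U$. If ${\sf T}\subset{\sf Mod}X$ is a localizing subcategory (closed under subobjects, quotients, extensions and direct sums), the quotient category ${\sf Mod}X/{\sf T}$ is identified, through the right adjoint of the quotient functor, with the full subcategory of ${\sf T}$-closed $X$-modules, i.e. those $M$ such that $\operatorname{Hom}(f,M)$ is bijective for every morphism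 $f$ with kernel and cokernel in ${\sf T}$. The *complement* $X\setminus W$ of a weakly closed subspace $W$ is given by ${\sf Mod}(X\setminus W)={\sf Mod}X/{\sf T}_W$, where ${\sf T}_W$ is the smallest localizing subcategory containing ${\sf Mod}W$. The *generic point* $\eta$ of an integral space $X$ is given by ${\sf Mod}\,\eta={\sf Mod}X/{\sf T}$, where ${\sf T}$ consists of the torsion modules, i.e. the $M$ with $\operatorname{Hom}(M,{\cal E}_X)=0$. **Proposition.** Let $X$ be an integral space with big injective ${\cal E}_X$, and let $W\neq X$ be a weakly closed subspace such that the only submodule of ${\cal E}_X$ that lies in ${\sf Mod}W$ is zero. Then 1. $\eta$ and $X\setminus W$ are weakly open subspaces of $X$, $\eta$ belongs to $X\setminus W$ (that is, ${\sf Mod}\,\eta\subset{\sf Mod}(X\setminus W)$), and $\overline{X\setminus W}=X$; 2. $X\setminus W$ is integral, and $k(X\setminus W)\cong k(X)$ as $k$-algebras (for every choice of big injectives). -/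

import Mathlib

open CategoryTheory CategoryTheory.Limits

universe v u u' t

namespace NCSpace

section Intrinsic

/-! Notions that make sense in a preadditive category. They are stated at this level so that they
apply verbatim to full subcategories. -/

variable {C : Type u} [Category.{v} C]

/-- `M` is a subquotient of `N`: a quotient object of a subobject of `N`. -/
def IsSubquotient (M N : C) : Prop :=
  ∃ (L : C) (i : L ⟶ N) (p : L ⟶ M), Mono i ∧ Epi p

variable (C) in
/-- A category is locally noetherian if it has a (small) set of noetherian generators. -/
def IsLocallyNoetherian : Prop :=
  ∃ (ι : Type v) (G : ι → C),
    (∀ i, IsNoetherianObject (G i)) ∧ (ObjectProperty.ofObj G).IsSeparating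

variable [Preadditive C]

/-- `E` is nonzero, and is not a direct sum of two nonzero objects. -/
def IsIndecomposable (E : C) : Prop :=
  ¬ IsZero E ∧ ∀ (Y Z : C) (b : BinaryBicone Y Z), Nonempty b.IsBilimit →
    Nonempty (E ≅ b.pt) → IsZero Y ∨ IsZero Z

/-- A big injective: an indecomposable injective `E` such that `End E` is a division ring and
every object is a subquotient of a direct sum of copies of `E`. (`End E` is nontrivial because
`E` is nonzero.) -/
structure IsBigInjective (E : C) : Prop where
  injective : Injective E
  indecomposable : IsIndecomposable E
  isUnit_of_ne_zero : ∀ f : End E, f ≠ 0 → IsUnit f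
  subquotient : ∀ M : C, ∃ (ι : Type v) (c : Cofan (fun _ : ι => E)),
    Nonempty (IsColimit c) ∧ IsSubquotient M c.pt

variable (C) in
/-- The preadditive category `C` is a Grothendieck category: it is abelian and as such
a Grothendieck abelian category. -/
def IsGrothendieck : Prop :=
  ∃ A : Abelian C, A.toPreadditive = ‹Preadditive C› ∧ IsGrothendieckAbelian.{v} C

variable (C) in
/-- The space `X` with `Mod X = C` is (locally noetherian and) integral. Its function field is
`End E` for a big injective `E`. -/
structure IsIntegral : Prop where
  isGrothendieck : IsGrothendieck C
  isLocallyNoetherian : IsLocallyNoetherian C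
  exists_bigInjective : ∃ E : C, IsBigInjective E

lemma isIndecomposable_iff [HasBinaryBiproducts C] (E : C) :
    IsIndecomposable E ↔ Indecomposable E := by
  refine and_congr_right fun _ => ⟨fun h Y Z e => ?_, ?_⟩
  · exact h Y Z (BinaryBiproduct.bicone Y Z) ⟨BinaryBiproduct.isBilimit Y Z⟩ ⟨e⟩
  · rintro h Y Z b ⟨hb⟩ ⟨e⟩
    exact h Y Z (e ≪≫ biprod.uniqueUpToIso Y Z hb)

end Intrinsic

variable {C : Type u} [Category.{v} C]

/-- A full subcategory `W` of `Mod X` is a weakly closed subspace if it is closed under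
subquotients (hence isomorphisms) and the inclusion functor has a right adjoint. -/
structure IsWeaklyClosed (W : ObjectProperty C) : Prop where
  closedUnderSubobjects : W.IsClosedUnderSubobjects
  closedUnderQuotients : W.IsClosedUnderQuotients
  exists_rightAdjoint : W.ι.IsLeftAdjoint

/-- A full subcategory `U` of `Mod X` is a weakly open subspace if the inclusion functor has
an exact left adjoint. -/
def IsWeaklyOpen (U : ObjectProperty C) : Prop :=
  ∃ (F : C ⥤ U.FullSubcategory) (_ : F ⊣ U.ι),
    PreservesFiniteLimits F ∧ PreservesFiniteColimits F

/-- The weak closure of `U`: the smallest weakly closed subspace that contains `U`, that is, the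
intersection of all of these. -/
def weakClosure (U : ObjectProperty C) : ObjectProperty C :=
  fun M => ∀ Z : ObjectProperty C, IsWeaklyClosed Z → U ≤ Z → Z M

section Abelian

open scoped ZeroObject

variable [Abelian C]

/-- A localizing subcategory: closed under subobjects, quotients, extensions and direct sums. -/
structure IsLocalizing (T : ObjectProperty C) : Prop where
  isSerreClass : T.IsSerreClass
  closedUnderCoproducts : ∀ ι : Type v, T.IsClosedUnderColimitsOfShape (Discrete ι)

/-- The smallest localizing subcategory that contains `W`. -/
def localizingClosure (W : ObjectProperty C) : ObjectProperty C :=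
  fun M => ∀ T : ObjectProperty C, IsLocalizing T → W ≤ T → T M

/-- The quotient category `Mod X / T`, viewed as a full subcategory of `Mod X` by means of the
right adjoint of the quotient functor: it consists of the `T`-closed objects `M`, those for which
`Hom(f, M)` is bijective for all `f` with kernel and cokernel in `T`
(see `essImage_rightAdjoint`). -/
def quotientSubspace (T : ObjectProperty C) : ObjectProperty C :=
  fun M => ∀ ⦃Y Z : C⦄ (f : Y ⟶ Z), T (kernel f) → T (cokernel f) →
    Function.Bijective (fun g : Z ⟶ M => f ≫ g)

/-- The torsion objects with respect to a big injective `E`. -/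
def torsion (E : C) : ObjectProperty C :=
  fun M => ∀ f : M ⟶ E, f = 0

/-- The generic point `η` of an integral space with big injective `E`, as a subspace:
`Mod η` is the quotient of `Mod X` by the torsion objects. -/
def genericPoint (E : C) : ObjectProperty C :=
  quotientSubspace (torsion E)

/-- The complement `X ∖ W` of a weakly closed subspace `W`: `Mod (X ∖ W)` is the quotient of
`Mod X` by the localizing subcategory generated by `Mod W`. -/
def complement (W : ObjectProperty C) : ObjectProperty C :=
  quotientSubspace (localizingClosure W)

lemma quotientSubspace_eq (T : ObjectProperty C) [T.IsSerreClass] :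
    quotientSubspace T = T.isoModSerre.isLocal := by
  ext M
  exact ⟨fun h Y Z f hf => h f hf.1 hf.2, fun h Y Z f h1 h2 => h f ⟨h1, h2⟩⟩

/-- If `L : Mod X ⥤ D` is a quotient functor by a Serre subcategory `T` and `G` is right adjoint
to `L`, then `quotientSubspace T` is the essential image of `G`. -/
lemma essImage_rightAdjoint (T : ObjectProperty C) [T.IsSerreClass]
    {D : Type u'} [Category.{t} D] (L : C ⥤ D) [L.IsLocalization T.isoModSerre]
    (G : D ⥤ C) (adj : L ⊣ G) : G.essImage = quotientSubspace T := by
  rw [quotientSubspace_eq]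
  ext M
  constructor
  · rintro ⟨D', ⟨e⟩⟩
    refine T.isoModSerre.isLocal.prop_of_iso e ?_
    intro Y Z f hf
    have : IsIso (L.map f) := Localization.inverts L T.isoModSerre f hf
    constructor
    · intro g₁ g₂ h
      apply (adj.homEquiv _ _).symm.injective
      rw [← cancel_epi (L.map f), ← adj.homEquiv_naturality_left_symm,
        ← adj.homEquiv_naturality_left_symm]
      exact congrArg _ h
    · intro g
      refine ⟨adj.homEquiv _ _ (inv (L.map f) ≫ (adj.homEquiv _ _).symm g), ?_⟩
      dsimp only
      rw [← adj.homEquiv_naturality_left, IsIso.hom_inv_id_assoc, Equiv.apply_symm_apply]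
  · intro hM
    have key : ∀ Z : C, Function.Bijective (fun g : Z ⟶ M => L.map g) := by
      intro Z
      constructor
      · intro g₁ g₂ h
        obtain ⟨Z', s, hs, h'⟩ := (MorphismProperty.map_eq_iff_precomp L T.isoModSerre g₁ g₂).1 h
        exact (hM s hs).1 h'
      · intro g
        obtain ⟨φ, rfl⟩ := Localization.exists_rightFraction L T.isoModSerre g
        obtain ⟨g', hg'⟩ := (hM φ.s φ.hs).2 φ.f
        refine ⟨g', ?_⟩
        have : IsIso (L.map φ.s) := Localization.inverts L T.isoModSerre φ.s φ.hs
        rw [← cancel_epi (L.map φ.s), MorphismProperty.RightFraction.map_s_comp_map]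
        dsimp only at hg' ⊢
        rw [← L.map_comp, hg']
    have key' : ∀ Z : C, Function.Bijective (fun g : Z ⟶ M => g ≫ adj.unit.app M) := by
      intro Z
      have : (fun g : Z ⟶ M => g ≫ adj.unit.app M) =
          (adj.homEquiv Z (L.obj M)) ∘ (fun g : Z ⟶ M => L.map g) := by
        ext g
        simp [Adjunction.homEquiv_unit]
      rw [this]
      exact (Equiv.bijective _).comp (key Z)
    obtain ⟨r, hr⟩ := (key' _).2 (𝟙 _)
    dsimp only at hr
    have : IsIso (adj.unit.app M) := ⟨r, (key' _).1 (by simp [hr]), hr⟩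
    exact ⟨L.obj M, ⟨(asIso (adj.unit.app M)).symm⟩⟩

lemma isLocalizing_localizingClosure (W : ObjectProperty C) :
    IsLocalizing (localizingClosure W) where
  isSerreClass :=
    { exists_zero := ⟨0, isZero_zero C, fun T hT _ => by
        have := hT.isSerreClass
        exact T.prop_of_isZero (isZero_zero C)⟩
      prop_of_mono := fun f _ h T hT hW => by
        have := hT.isSerreClass
        exact T.prop_of_mono f (h T hT hW)
      prop_of_epi := fun f _ h T hT hW => by
        have := hT.isSerreClass
        exact T.prop_of_epi f (h T hT hW)
      prop_X₂_of_shortExact := fun hS h₁ h₃ T hT hW => by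
        have := hT.isSerreClass
        exact T.prop_X₂_of_shortExact hS (h₁ T hT hW) (h₃ T hT hW) }
  closedUnderCoproducts ι := ⟨fun _ ⟨h⟩ T hT hW => by
    have := hT.closedUnderCoproducts ι
    exact T.prop_of_isColimit h.isColimit (fun j => h.prop_diag_obj j T hT hW)⟩

lemma isLocalizing_torsion (E : C) [Injective E] : IsLocalizing (torsion E) where
  isSerreClass :=
    { exists_zero := ⟨0, isZero_zero C, fun f => (isZero_zero C).eq_of_src _ _⟩
      prop_of_mono := fun {X Y} i _ (h : ∀ f : Y ⟶ E, f = 0) f => by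
        rw [← Injective.comp_factorThru f i, h (Injective.factorThru f i), comp_zero]
      prop_of_epi := fun {X Y} p _ (h : ∀ f : X ⟶ E, f = 0) f => by
        rw [← cancel_epi p, h (p ≫ f), comp_zero]
      prop_X₂_of_shortExact := fun {S} hS (h₁ : ∀ f : S.X₁ ⟶ E, f = 0)
          (h₃ : ∀ f : S.X₃ ⟶ E, f = 0) f => by
        have := hS.epi_g
        rw [← hS.exact.g_desc f (h₁ _), h₃ (hS.exact.desc f (h₁ _)), comp_zero] }
  closedUnderCoproducts ι := ⟨fun _ ⟨h⟩ f => h.isColimit.hom_ext (fun j =>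
    (h.prop_diag_obj j (h.ι.app j ≫ f)).trans comp_zero.symm)⟩

end Abelian

end NCSpace

/-! Two facts carry the proof. First, if `W` contains `N`, the image of any map `N ⟶ E` is a
quotient of `N`, hence a submodule of `E` lying in `W`, hence zero. So `W`, and with it the
localizing subcategory it generates, consists of torsion modules (`localizingClosure_le_torsion`).
Passing to closed objects reverses this inclusion, so `η` belongs to `X ∖ W`. Being injective, `E`
is torsion-closed (`genericPoint_self`) and so lies in both. A weakly closed subspace containing `E`
contains direct sums of copies of `E` and their subquotients, that is, everything.

Second, by Gabriel's theory the quotient functor by a localizing subcategory is exact and has a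
right adjoint (`isWeaklyOpen_quotientSubspace`). Along the resulting exact reflector the
Grothendieck property, noetherian generators and the big injective `E` all descend to `X ∖ W`.
Fullness keeps the endomorphism ring of `E`, and uniqueness of big injectives
(`IsBigInjective.nonempty_iso`) settles the other choices. -/

namespace NCSpace

/-! ### Quotients by localizing subcategories and their right adjoints. -/

section SerreLocalization

variable {C : Type u} [Category.{v} C] [Abelian C]

/-- A coproduct of isomorphisms modulo `T` is an isomorphism modulo `T`. -/
lemma isoModSerre_colimMap (T : ObjectProperty C) [T.IsSerreClass] {ι : Type t}
    [T.IsClosedUnderColimitsOfShape (Discrete ι)] [HasColimitsOfShape (Discrete ι) C]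
    [HasExactColimitsOfShape (Discrete ι) C] {K K' : Discrete ι ⥤ C} (α : K ⟶ K')
    (hα : ∀ j, T.isoModSerre (α.app j)) : T.isoModSerre (colimMap α) := by
  have : (colim (J := Discrete ι) (C := C)).Additive :=
    Functor.additive_of_preserves_binary_products _
  -- Since `colim` is exact here, it commutes with kernels and cokernels.
  have hk : T (colimit (kernel α)) := T.prop_colimit _ fun j =>
    T.prop_of_iso (PreservesKernel.iso ((evaluation _ C).obj j) α).symm (hα j).1
  have hc : T (colimit (cokernel α)) := T.prop_colimit _ fun j =>
    T.prop_of_iso (PreservesCokernel.iso ((evaluation _ C).obj j) α).symm (hα j).2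
  exact ⟨T.prop_of_iso (PreservesKernel.iso colim α) hk,
    T.prop_of_iso (PreservesCokernel.iso colim α) hc⟩

/-- The quotient functor by a Serre class that is closed under exact coproducts preserves these. -/
lemma preservesCoproducts_of_isLocalization (T : ObjectProperty C) [T.IsSerreClass] {ι : Type t}
    [T.IsClosedUnderColimitsOfShape (Discrete ι)] [HasColimitsOfShape (Discrete ι) C]
    [HasExactColimitsOfShape (Discrete ι) C] {D : Type u'} [Category.{t} D] (L : C ⥤ D)
    [L.IsLocalization T.isoModSerre] : PreservesColimitsOfShape (Discrete ι) L where
  preservesColimit {K} := by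
    have := Localization.essSurj L T.isoModSerre
    have hext : ∀ {Y : D} (g₁ g₂ : L.obj (colimit K) ⟶ Y),
        (∀ j, L.map (colimit.ι K j) ≫ g₁ = L.map (colimit.ι K j) ≫ g₂) → g₁ = g₂ := by
      intro Y g₁ g₂ h
      -- A common denominator for both morphisms reduces the claim to `L.map φ.f = L.map φ.f'`.
      obtain ⟨φ, h₁, h₂⟩ := Localization.exists_leftFraction₂ L T.isoModSerre
        (g₁ ≫ (L.objObjPreimageIso Y).inv) (g₂ ≫ (L.objObjPreimageIso Y).inv)
      have : IsIso (L.map φ.s) := Localization.inverts L T.isoModSerre φ.s φ.hs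
      have e₁ := φ.fst.map_comp_map_s L (Localization.inverts L T.isoModSerre)
      have e₂ := φ.snd.map_comp_map_s L (Localization.inverts L T.isoModSerre)
      rw [← h₁] at e₁
      rw [← h₂] at e₂
      dsimp at e₁ e₂
      have key : ∀ j, L.map (colimit.ι K j ≫ φ.f) = L.map (colimit.ι K j ≫ φ.f') := by
        intro j
        rw [L.map_comp, L.map_comp, ← e₁, ← e₂]
        simp only [Category.assoc, reassoc_of% (h j)]
      simp only [MorphismProperty.map_eq_iff_precomp L T.isoModSerre] at key
      choose X s hs hX using key
      -- The denominators on the summands assemble into one map of coproducts, still inverted by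
      -- `L`.
      let α : Discrete.functor (fun j => X ⟨j⟩) ⟶ K := Discrete.natTrans fun j => s j
      have hα := isoModSerre_colimMap T α fun j => hs j
      have : IsIso (L.map (colimMap α)) := Localization.inverts L T.isoModSerre _ hα
      have hf : L.map φ.f = L.map φ.f' := by
        rw [← cancel_epi (L.map (colimMap α)), ← L.map_comp, ← L.map_comp]
        congr 1
        ext j
        simpa [α] using hX ⟨j⟩
      rw [← hf, ← e₁, cancel_mono, cancel_mono] at e₂
      exact e₂.symm
    have hex : ∀ {Y : D} (g : ∀ j, L.obj (K.obj j) ⟶ Y),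
        ∃ l : L.obj (colimit K) ⟶ Y, ∀ j, L.map (colimit.ι K j) ≫ l = g j := by
      intro Y g
      have hg := fun j => Localization.exists_rightFraction L T.isoModSerre
        (g j ≫ (L.objObjPreimageIso Y).inv)
      choose φ hφ using hg
      let α : Discrete.functor (fun j => (φ ⟨j⟩).X') ⟶ K := Discrete.natTrans fun j => (φ j).s
      have hα := isoModSerre_colimMap T α fun j => (φ j).hs
      have : IsIso (L.map (colimMap α)) := Localization.inverts L T.isoModSerre _ hα
      let β : colimit (Discrete.functor (fun j => (φ ⟨j⟩).X')) ⟶ L.objPreimage Y :=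
        Sigma.desc fun j => (φ ⟨j⟩).f
      refine ⟨inv (L.map (colimMap α)) ≫ L.map β ≫ (L.objObjPreimageIso Y).hom, fun j => ?_⟩
      have : IsIso (L.map (φ j).s) := Localization.inverts L T.isoModSerre _ (φ j).hs
      rw [← cancel_epi (L.map (φ j).s), ← L.map_comp_assoc]
      have h₁ : (φ j).s ≫ colimit.ι K j =
          colimit.ι (Discrete.functor (fun j => (φ ⟨j⟩).X')) j ≫ colimMap α := by
        simp [α]
      have h₂ : colimit.ι (Discrete.functor (fun j => (φ ⟨j⟩).X')) j ≫ β = (φ j).f := by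
        obtain ⟨j⟩ := j
        exact colimit.ι_desc _ _
      rw [h₁, L.map_comp, Category.assoc, IsIso.hom_inv_id_assoc, ← L.map_comp_assoc, h₂,
        ← (φ j).map_s_comp_map L (Localization.inverts L T.isoModSerre), ← hφ]
      simp
    exact preservesColimit_of_preserves_colimit_cocone (colimit.isColimit K)
      { desc s := (hex fun j => s.ι.app j).choose
        fac s j := (hex fun j => s.ι.app j).choose_spec j
        uniq s m hm := hext _ _ fun j =>
          (hm j).trans ((hex fun j => s.ι.app j).choose_spec j).symm }

/-- The quotient of a well-powered abelian category by a Serre class is locally small: every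
morphism `L.obj X ⟶ L.obj Y` comes from a morphism from a subobject of `X` to a quotient of `Y`. -/
lemma locallySmall_of_isLocalization (T : ObjectProperty C) [T.IsSerreClass] [WellPowered.{v} C]
    {D : Type u'} [Category.{t} D] (L : C ⥤ D) [L.IsLocalization T.isoModSerre] :
    LocallySmall.{v} D where
  hom_small X₀ Y₀ := by
    have := Localization.essSurj L T.isoModSerre
    suffices h : ∀ X Y : C, Small.{v} (L.obj X ⟶ L.obj Y) by
      let e : (L.obj (L.objPreimage X₀) ⟶ L.obj (L.objPreimage Y₀)) ≃ (X₀ ⟶ Y₀) :=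
        (L.objObjPreimageIso X₀).homCongr (L.objObjPreimageIso Y₀)
      have := h (L.objPreimage X₀) (L.objPreimage Y₀)
      exact small_of_surjective e.surjective
    intro X Y
    let S := Σ (I : {I : Subobject X // T.isoModSerre I.arrow})
      (J : {J : Subobject Y // T.isoModSerre (cokernel.π J.arrow)}),
      ((I.1 : C) ⟶ cokernel J.1.arrow)
    have hI : ∀ I : {I : Subobject X // T.isoModSerre I.arrow}, IsIso (L.map I.1.arrow) :=
      fun I => Localization.inverts L T.isoModSerre _ I.2
    have hJ : ∀ J : {J : Subobject Y // T.isoModSerre (cokernel.π J.arrow)},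
        IsIso (L.map (cokernel.π J.1.arrow)) := fun J => Localization.inverts L T.isoModSerre _ J.2
    let Φ : S → (L.obj X ⟶ L.obj Y) := fun x =>
      inv (L.map x.1.1.arrow) ≫ L.map x.2.2 ≫ inv (L.map (cokernel.π x.2.1.1.arrow))
    refine small_of_surjective (f := Φ) fun g => ?_
    obtain ⟨φ, rfl⟩ := Localization.exists_rightFraction L T.isoModSerre g
    have hs : IsIso (L.map φ.s) := Localization.inverts L T.isoModSerre _ φ.hs
    let I : Subobject X := imageSubobject φ.s
    let p : φ.X' ⟶ (I : C) := factorThruImageSubobject φ.s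
    have hp : p ≫ I.arrow = φ.s := imageSubobject_arrow_comp φ.s
    have hI' : T.isoModSerre I.arrow := by
      rw [ObjectProperty.isoModSerre_iff_of_mono]
      have hc : T.isoModSerre (p ≫ I.arrow) := hp ▸ φ.hs
      exact T.prop_of_epi (cokernel.map (p ≫ I.arrow) I.arrow p (𝟙 _) (by simp)) hc.2
    -- `φ.f` descends to the image of `φ.s` only after dividing `Y` by the image of `ker φ.s`, which
    -- is in `T`.
    let J : Subobject Y := imageSubobject (kernel.ι φ.s ≫ φ.f)
    have hJ' : T.isoModSerre (cokernel.π J.arrow) := by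
      rw [ObjectProperty.isoModSerre_iff_of_epi]
      exact T.prop_of_epi (Abelian.factorThruImage J.arrow)
        (T.prop_of_epi (factorThruImageSubobject (kernel.ι φ.s ≫ φ.f)) φ.hs.1)
    have hw : kernel.ι p ≫ φ.f ≫ cokernel.π J.arrow = 0 := by
      have h₁ : kernel.ι p ≫ φ.s = 0 := by rw [← hp, kernel.condition_assoc, zero_comp]
      have h₂ : (kernel.ι φ.s ≫ φ.f) ≫ cokernel.π J.arrow = 0 := by
        rw [← imageSubobject_arrow_comp (kernel.ι φ.s ≫ φ.f), Category.assoc, cokernel.condition,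
          comp_zero]
      rw [← kernel.lift_ι φ.s (kernel.ι p) h₁, Category.assoc, ← Category.assoc (kernel.ι φ.s), h₂,
        comp_zero]
    let f' : (I : C) ⟶ cokernel J.arrow := Abelian.epiDesc p (φ.f ≫ cokernel.π J.arrow) hw
    refine ⟨⟨⟨I, hI'⟩, ⟨J, hJ'⟩, f'⟩, ?_⟩
    have := hI ⟨I, hI'⟩
    have := hJ ⟨J, hJ'⟩
    dsimp [Φ]
    rw [← cancel_epi (L.map φ.s), φ.map_s_comp_map L, ← hp, L.map_comp, Category.assoc,
      IsIso.hom_inv_id_assoc, ← L.map_comp_assoc, Abelian.comp_epiDesc, L.map_comp]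
    simp

/-- If a localization functor has a right adjoint, the counit of the adjunction is invertible. -/
lemma isIso_counit_of_isLocalization {C : Type u} [Category.{v} C] {D : Type u'} [Category.{t} D]
    (S : MorphismProperty C) (L : C ⥤ D) [L.IsLocalization S] {G : D ⥤ C} (adj : L ⊣ G) :
    IsIso adj.counit := by
  -- The inverse of the counit: the unit, whiskered with `L`, descends along the localization.
  let σ : 𝟭 D ⟶ G ⋙ L := Localization.liftNatTrans L S L (L ⋙ G ⋙ L) (𝟭 D) (G ⋙ L)
    (Functor.whiskerRight adj.unit L)
  have hσ : ∀ X, σ.app (L.obj X) = L.map (adj.unit.app X) := fun X => by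
    simp [σ, Localization.liftNatTrans_app, Localization.Lifting.iso]
  refine ⟨σ, ?_, Localization.natTrans_ext L S fun X => ?_⟩
  · ext X
    have h := σ.naturality (adj.counit.app X)
    dsimp at h
    rw [hσ, ← L.map_comp, adj.right_triangle_components] at h
    exact h.trans (L.map_id _)
  · rw [NatTrans.comp_app, hσ]
    exact adj.left_triangle_components X

/-- The inclusion of the quotient category by a localizing subcategory of a Grothendieck category
has an exact left adjoint. -/
lemma isWeaklyOpen_quotientSubspace [IsGrothendieckAbelian.{v} C] {T : ObjectProperty C}
    (hT : IsLocalizing T) : IsWeaklyOpen (quotientSubspace T) := by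
  have := hT.isSerreClass
  have := hT.closedUnderCoproducts
  have := locallySmall_of_isLocalization T T.isoModSerre.Q
  -- This model has its morphisms in `Type v`, as the adjoint functor theorem below needs.
  let := MorphismProperty.hasLocalizationOfLocallySmall.{v} T.isoModSerre T.isoModSerre.Q
  let L := T.isoModSerre.Q'
  let : Abelian T.isoModSerre.Localization' := ObjectProperty.SerreClassLocalization.abelian L T
  have : PreservesFiniteLimits L :=
    ObjectProperty.SerreClassLocalization.preservesFiniteLimits L T
  have : PreservesFiniteColimits L :=
    ObjectProperty.SerreClassLocalization.preservesFiniteColimits L T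
  have : ∀ J : Type v, PreservesColimitsOfShape (Discrete J) L := fun J =>
    preservesCoproducts_of_isLocalization T L
  have : PreservesColimits L := preservesColimits_of_preservesCoequalizers_and_coproducts L
  have : L.IsLeftAdjoint :=
    isLeftAdjoint_of_preservesColimits_of_isSeparating (isSeparator_separator C) L
  let adj := Adjunction.ofIsLeftAdjoint L
  have hG := essImage_rightAdjoint T L L.rightAdjoint adj
  have := isIso_counit_of_isLocalization T.isoModSerre L adj
  have := adj.fullyFaithfulROfIsIsoCounit.full
  have := adj.fullyFaithfulROfIsIsoCounit.faithful
  let K : T.isoModSerre.Localization' ⥤ (quotientSubspace T).FullSubcategory :=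
    (quotientSubspace T).lift L.rightAdjoint fun X => by
      rw [← hG]
      exact L.rightAdjoint.obj_mem_essImage X
  have : K.EssSurj := ⟨fun M => by
    obtain ⟨X, ⟨e⟩⟩ : L.rightAdjoint.essImage M.obj := by
      rw [hG]
      exact M.property
    exact ⟨X, ⟨(quotientSubspace T).isoMk e⟩⟩⟩
  have : K.IsEquivalence := { }
  let e : K.inv ⋙ L.rightAdjoint ≅ (quotientSubspace T).ι :=
    Functor.isoWhiskerLeft K.inv ((quotientSubspace T).liftCompιIso _ _).symm ≪≫
      (Functor.associator _ _ _).symm ≪≫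
      Functor.isoWhiskerRight K.asEquivalence.counitIso _ ≪≫ Functor.leftUnitor _
  exact ⟨L ⋙ K, (adj.comp K.asEquivalence.toAdjunction).ofNatIsoRight e,
    comp_preservesFiniteLimits _ _, comp_preservesFiniteColimits _ _⟩

end SerreLocalization

/-! ### Transfer of properties along an exact reflector. -/

section Reflective

variable {C : Type u} [Category.{v} C] {U : ObjectProperty C} {F : C ⥤ U.FullSubcategory}

/-- Maps out of `F.obj Z` are transposes of maps out of `Z`; this makes reflected generators
separating. -/
lemma map_eq_map_of_reflective (adj : F ⊣ U.ι) {Z : C} {X Y : U.FullSubcategory} {f g : X ⟶ Y}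
    (h : ∀ p : F.obj Z ⟶ X, p ≫ f = p ≫ g) (q : Z ⟶ U.ι.obj X) :
    q ≫ U.ι.map f = q ≫ U.ι.map g := by
  have := congrArg (adj.homEquiv _ _) (h ((adj.homEquiv _ _).symm q))
  rwa [adj.homEquiv_naturality_right, adj.homEquiv_naturality_right, Equiv.apply_symm_apply]
    at this

/-- A reflector maps a separating family to a separating family. -/
lemma isSeparating_ofObj_of_reflective (adj : F ⊣ U.ι) {ι : Type t} (G : ι → C)
    (hG : (ObjectProperty.ofObj G).IsSeparating) :
    (ObjectProperty.ofObj fun i => F.obj (G i)).IsSeparating := by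
  intro X Y f g h
  apply U.ι.map_injective
  apply hG
  rintro _ ⟨i⟩ q
  exact map_eq_map_of_reflective adj (fun p => h _ ⟨i⟩ p) q

/-- An exact reflector maps noetherian objects to noetherian objects. -/
lemma isNoetherianObject_of_reflective [HasPullbacks C] (adj : F ⊣ U.ι) [PreservesFiniteLimits F]
    (X : C) [IsNoetherianObject X] : IsNoetherianObject (F.obj X) := by
  have : U.ι.IsRightAdjoint := ⟨F, ⟨adj⟩⟩
  -- Pull subobjects back along the unit. As `F` inverts the unit and preserves pullbacks, applying
  -- `F` recovers `S`, so `φ` reflects the order and chains stabilize.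
  let φ : Subobject (F.obj X) → Subobject X := fun S =>
    Subobject.mk (pullback.snd (U.ι.map S.arrow) (adj.unit.app X))
  have hφ : Monotone φ := fun S S' h => by
    refine Subobject.mk_le_mk_of_comm (pullback.lift (pullback.fst _ _ ≫ U.ι.map (S.ofLE S' h))
      (pullback.snd _ _) ?_) (pullback.lift_snd _ _ _)
    rw [Category.assoc, ← U.ι.map_comp, Subobject.ofLE_arrow, pullback.condition]
  have hunit : IsIso (F.map (adj.unit.app X)) := by
    have := adj.left_triangle_components X
    exact IsIso.of_isIso_fac_right (hh := IsIso.id (F.obj X)) this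
  have hiso : ∀ S : Subobject (F.obj X),
      ∃ e : F.obj (pullback (U.ι.map S.arrow) (adj.unit.app X)) ≅ (S : U.FullSubcategory),
        e.hom ≫ S.arrow = F.map (pullback.snd (U.ι.map S.arrow) (adj.unit.app X)) := by
    intro S
    have sq := (IsPullback.of_hasPullback (U.ι.map S.arrow) (adj.unit.app X)).map F
    have : IsIso (F.map (pullback.fst (U.ι.map S.arrow) (adj.unit.app X))) :=
      sq.isIso_fst_of_isIso
    refine ⟨asIso (F.map (pullback.fst (U.ι.map S.arrow) (adj.unit.app X))) ≪≫
      asIso (adj.counit.app _), ?_⟩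
    have h₁ := adj.counit.naturality S.arrow
    have h₂ := sq.w
    have h₃ := adj.left_triangle_components X
    dsimp at h₁ h₂ h₃ ⊢
    rw [Category.assoc, ← h₁, reassoc_of% h₂, h₃, Category.comp_id]
  have hφ' : ∀ S S', φ S ≤ φ S' → S ≤ S' := fun S S' h => by
    obtain ⟨e, he⟩ := hiso S
    obtain ⟨e', he'⟩ := hiso S'
    refine Subobject.le_of_comm (e.inv ≫ F.map (Subobject.ofMkLEMk _ _ h) ≫ e'.hom) ?_
    rw [Category.assoc, Category.assoc, he', ← F.map_comp, Subobject.ofMkLEMk_comp, ← he,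
      Iso.inv_hom_id_assoc]
  rw [isNoetherianObject_iff_monotone_chain_condition]
  intro f
  obtain ⟨n, hn⟩ := monotone_chain_condition_of_isNoetherianObject (X := X) ⟨_, hφ.comp f.2⟩
  exact ⟨n, fun m hm => le_antisymm (f.2 hm) (hφ' _ _ (hn m hm).ge)⟩

lemma isLocallyNoetherian_of_reflective [HasPullbacks C] (adj : F ⊣ U.ι) [PreservesFiniteLimits F]
    (h : IsLocallyNoetherian C) : IsLocallyNoetherian U.FullSubcategory := by
  obtain ⟨ι, G, hG, hs⟩ := h
  refine ⟨ι, fun i => F.obj (G i), fun i => ?_, isSeparating_ofObj_of_reflective adj G hs⟩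
  have := hG i
  exact isNoetherianObject_of_reflective adj (G i)

/-- A reflective subcategory of a Grothendieck category with exact reflector is a Grothendieck
category. -/
lemma isGrothendieck_of_reflective [Abelian C] [IsGrothendieckAbelian.{v} C] (adj : F ⊣ U.ι)
    [PreservesFiniteLimits F] : IsGrothendieck U.FullSubcategory := by
  let : Reflective U.ι := ⟨F, adj⟩
  have : HasFiniteProducts U.FullSubcategory :=
    ⟨fun n => hasLimitsOfShape_of_reflective U.ι⟩
  have : F.IsLeftAdjoint := ⟨_, ⟨adj⟩⟩
  have : HasZeroObject U.FullSubcategory := hasZeroObject_of_hasTerminal_object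
  have : F.PreservesZeroMorphisms := Functor.preservesZeroMorphisms_of_isLeftAdjoint F
  let A : Abelian U.FullSubcategory := abelianOfAdjunction U.ι F (asIso adj.counit) adj
  have : HasFilteredColimitsOfSize.{v, v} U.FullSubcategory :=
    ⟨fun J _ _ => hasColimitsOfShape_of_reflective U.ι⟩
  exact ⟨A, rfl, {
    ab5OfSize := ⟨fun J _ _ => adj.hasExactColimitsOfShape J⟩
    hasSeparator := ⟨F.obj (separator C), fun X Y f g h => U.ι.map_injective
      ((isSeparator_def _).1 (isSeparator_separator C) _ _ fun q =>
        map_eq_map_of_reflective adj (fun p => h _ ⟨⟨⟩⟩ p) q)⟩ }⟩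

end Reflective

/-! ### Uniqueness and transfer of big injectives. -/

section BigInjective

/-- Injectivity of `M` extends the epimorphism onto `M` from a subobject to the whole coproduct. -/
lemma IsBigInjective.exists_epi {D : Type u} [Category.{v} D] [Preadditive D] {E M : D}
    (hE : IsBigInjective E) (hM : Injective M) :
    ∃ (ι : Type v) (c : Cofan (fun _ : ι => E)) (_ : IsColimit c) (h : c.pt ⟶ M), Epi h := by
  obtain ⟨ι, c, ⟨hc⟩, L, i, p, _, _⟩ := hE.subquotient M
  exact ⟨ι, c, hc, Injective.factorThru p i,
    epi_of_epi_fac (Injective.comp_factorThru p i)⟩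

/-- A big injective is unique up to isomorphism. -/
lemma IsBigInjective.nonempty_iso {D : Type u} [Category.{v} D] [Preadditive D] {E E' : D}
    (hE : IsBigInjective E) (hE' : IsBigInjective E') : Nonempty (E ≅ E') := by
  obtain ⟨ι, c, hc, h, _⟩ := hE.exists_epi hE'.injective
  obtain ⟨ι', c', hc', h', _⟩ := hE'.exists_epi hE.injective
  have hne : h' ≠ 0 := fun h₀ => hE.indecomposable.1 <| (IsZero.iff_id_eq_zero E).2 <| by
    rw [← cancel_epi h', h₀, zero_comp, zero_comp]
  obtain ⟨j', hj'⟩ : ∃ j', c'.inj j' ≫ h' ≠ 0 := by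
    by_contra! H
    exact hne (Cofan.IsColimit.hom_ext hc' _ _ fun j => by rw [H, comp_zero])
  obtain ⟨j, hj⟩ : ∃ j, c.inj j ≫ h ≫ c'.inj j' ≫ h' ≠ 0 := by
    by_contra! H
    refine hj' ?_
    rw [← cancel_epi h, comp_zero]
    exact Cofan.IsColimit.hom_ext hc _ _ fun j => by rw [H, comp_zero]
  have hu : IsIso (c.inj j ≫ h ≫ c'.inj j' ≫ h') :=
    (isUnit_iff_isIso _).1 (hE.isUnit_of_ne_zero _ hj)
  let f : E ⟶ E' := c.inj j ≫ h
  let g : E' ⟶ E := c'.inj j' ≫ h'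
  have hfg : IsIso (f ≫ g) := by simpa only [f, g, Category.assoc] using hu
  -- If `g ≫ f` vanished, the isomorphism `f ≫ g` would square to zero.
  have hgf : IsIso (g ≫ f) := by
    refine (isUnit_iff_isIso _).1 (hE'.isUnit_of_ne_zero _ fun h₀ => hj ?_)
    have h₁ : (f ≫ g) ≫ (f ≫ g) = 0 := by
      rw [Category.assoc, reassoc_of% h₀, zero_comp, comp_zero]
    have h₂ : f ≫ g = 0 := by rw [← cancel_epi (f ≫ g), h₁, comp_zero]
    simpa only [f, g, Category.assoc] using h₂
  have : Mono f := mono_of_mono f g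
  have : IsSplitEpi f := ⟨⟨inv (g ≫ f) ≫ g, by simp⟩⟩
  have := isIso_of_mono_of_isSplitEpi f
  exact ⟨asIso f⟩

/-- An object all of whose nonzero endomorphisms are invertible is indecomposable. -/
lemma isIndecomposable_of_isUnit {D : Type u} [Category.{v} D] [Preadditive D] {E : D}
    (h₀ : ¬ IsZero E) (h : ∀ f : End E, f ≠ 0 → IsUnit f) : IsIndecomposable E := by
  refine ⟨h₀, fun Y Z b ⟨hb⟩ ⟨e⟩ => or_iff_not_imp_left.2 fun hY => ?_⟩
  -- The projector onto `Y`: if nonzero it is invertible, yet it kills `Z`.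
  let f : E ⟶ E := e.hom ≫ b.fst ≫ b.inl ≫ e.inv
  have hf : f ≠ 0 := fun hf => hY <| (IsZero.iff_id_eq_zero Y).2 <| by
    have : b.inl ≫ e.inv ≫ f ≫ e.hom ≫ b.fst = 𝟙 Y := by simp [f]
    rw [← this, hf]
    simp
  have : IsIso f := (isUnit_iff_isIso _).1 (h f hf)
  rw [IsZero.iff_id_eq_zero]
  have h₁ : (b.inr ≫ e.inv) ≫ f = 0 := by simp [f]
  have h₂ : b.inr ≫ e.inv = 0 := by rw [← cancel_mono f, h₁, zero_comp]
  rw [← b.inr_snd, ← Category.comp_id b.inr, ← e.inv_hom_id, reassoc_of% h₂, zero_comp, zero_comp]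

/-- A big injective of `C` that belongs to a reflective subcategory with exact reflector is a big
injective there. -/
lemma IsBigInjective.of_reflective {C : Type u} [Category.{v} C] [Preadditive C]
    {U : ObjectProperty C} {F : C ⥤ U.FullSubcategory} (adj : F ⊣ U.ι)
    [PreservesFiniteLimits F] {E : C} (hE : IsBigInjective E) (hU : U E) :
    IsBigInjective (⟨E, hU⟩ : U.FullSubcategory) := by
  have hR : U.ι.IsRightAdjoint := ⟨F, ⟨adj⟩⟩
  have hL : F.IsLeftAdjoint := ⟨_, ⟨adj⟩⟩
  have hinj := hE.injective
  have hunit : ∀ f : End (⟨E, hU⟩ : U.FullSubcategory), f ≠ 0 → IsUnit f := fun f hf => by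
    have : IsIso (U.ι.map f) := (isUnit_iff_isIso _).1 (hE.isUnit_of_ne_zero (U.ι.map f)
      fun h => hf (U.ι.map_injective h))
    exact (isUnit_iff_isIso _).2 (isIso_of_fully_faithful U.ι f)
  refine ⟨⟨fun {X Y} g f _ => ?_⟩, isIndecomposable_of_isUnit (fun h => ?_) hunit, hunit,
    fun M => ?_⟩
  · have : Injective (U.ι.obj ⟨E, hU⟩) := hinj
    exact ⟨U.ι.preimage (Injective.factorThru (U.ι.map g) (U.ι.map f)),
      U.ι.map_injective (by
        rw [U.ι.map_comp, U.ι.map_preimage, Injective.comp_factorThru])⟩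
  · refine hE.indecomposable.1 ((IsZero.iff_id_eq_zero E).2 ?_)
    exact congrArg U.ι.map (h.eq_of_src (𝟙 _) 0)
  · obtain ⟨ι, c, ⟨hc⟩, L, i, p, _, _⟩ := hE.subquotient M.obj
    let e : F.obj E ≅ ⟨E, hU⟩ := asIso (adj.counit.app ⟨E, hU⟩)
    let α : Discrete.functor (fun _ : ι => (⟨E, hU⟩ : U.FullSubcategory)) ≅
        Discrete.functor (fun _ : ι => E) ⋙ F := Discrete.natIso fun _ => e.symm
    exact ⟨ι, (Cocone.precompose α.hom).obj (F.mapCocone c),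
      ⟨(IsColimit.precomposeHomEquiv α _).symm (isColimitOfPreserves F hc)⟩,
      F.obj L, F.map i, F.map p ≫ adj.counit.app M, inferInstance,
      inferInstance⟩

end BigInjective

/-! ### Weak closure, torsion and closedness of the big injective. -/

section WeaklyClosed

variable {C : Type u} [Category.{v} C]

/-- A weakly closed subspace is closed under coproducts. -/
lemma IsWeaklyClosed.prop_of_isColimit_cofan {Z : ObjectProperty C}
    (hZ : IsWeaklyClosed Z) {ι : Type t} {X : ι → C} (c : Cofan X) (hc : IsColimit c)
    (hX : ∀ i, Z (X i)) : Z c.pt := by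
  have := hZ.closedUnderQuotients
  have := hZ.exists_rightAdjoint
  let adj := Adjunction.ofIsLeftAdjoint Z.ι
  -- Every coproduct inclusion factors through the counit, so `c.pt` is a quotient of an object of
  -- `Z`.
  have : Epi (adj.counit.app c.pt) := by
    refine ⟨fun f g h => Cofan.IsColimit.hom_ext hc _ _ fun i => ?_⟩
    let q : Z.ι.obj ⟨X i, hX i⟩ ⟶ c.pt := c.inj i
    have hq := (adj.homEquiv _ _).symm_apply_apply q
    rw [adj.homEquiv_counit] at hq
    change q ≫ f = q ≫ g
    rw [← hq, Category.assoc, Category.assoc]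
    exact congrArg _ h
  exact Z.prop_of_epi (adj.counit.app c.pt) (Z.ι.rightAdjoint.obj c.pt).property

lemma weakClosure_eq_top [Preadditive C] {U : ObjectProperty C} {E : C} (hE : IsBigInjective E)
    (hU : U E) : weakClosure U = ⊤ := by
  refine top_le_iff.1 fun M _ Z hZ hUZ => ?_
  have := hZ.closedUnderQuotients
  have := hZ.closedUnderSubobjects
  obtain ⟨ι, c, ⟨hc⟩, L, i, p, _, _⟩ := hE.subquotient M
  exact Z.prop_of_epi p (Z.prop_of_mono i
    (hZ.prop_of_isColimit_cofan c hc fun _ => hUZ _ hU))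

variable [Abelian C]

lemma quotientSubspace_antitone {T T' : ObjectProperty C} (h : T ≤ T') :
    quotientSubspace T' ≤ quotientSubspace T :=
  fun _ hM _ _ f h₁ h₂ => hM f (h _ h₁) (h _ h₂)

lemma localizingClosure_le_torsion {E : C} [Injective E] {W : ObjectProperty C}
    (hW : IsWeaklyClosed W) (hEW : ∀ (N : C) (i : N ⟶ E), Mono i → W N → IsZero N) :
    localizingClosure W ≤ torsion E := by
  refine fun M hM => hM _ (isLocalizing_torsion E) fun N hN f => ?_
  have := hW.closedUnderQuotients
  have h₀ := hEW _ (Abelian.image.ι f) inferInstance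
    (W.prop_of_epi (Abelian.factorThruImage f) hN)
  rw [← Abelian.image.fac f, h₀.eq_of_src (Abelian.image.ι f) 0, comp_zero]

/-- An injective object is closed with respect to its torsion objects. -/
lemma genericPoint_self (E : C) [Injective E] : genericPoint E E := by
  intro Y Z f hk hc
  constructor
  · intro g₁ g₂ h
    have h₁ : f ≫ (g₁ - g₂) = 0 := by
      rw [Preadditive.comp_sub, sub_eq_zero]
      exact h
    rw [← sub_eq_zero, ← cokernel.π_desc f _ h₁, hc (cokernel.desc f _ h₁), comp_zero]
  · intro g
    -- The kernel of `f` is torsion, so `g` kills it; injectivity then extends from the coimage to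
    -- `Z`.
    let g' : Abelian.coimage f ⟶ E := cokernel.desc (kernel.ι f) g (hk _)
    refine ⟨Injective.factorThru g' (Abelian.factorThruCoimage f), ?_⟩
    dsimp only
    have h := Abelian.coimage.fac f =≫ Injective.factorThru g' (Abelian.factorThruCoimage f)
    rw [Category.assoc, Injective.comp_factorThru] at h
    exact h.symm.trans (cokernel.π_desc _ _ _)

end WeaklyClosed

/-- Isomorphic objects of a full subcategory and of the ambient category have the same
endomorphism algebra. -/
lemma nonempty_end_algEquiv {k : Type*} [CommRing k] {C : Type u} [Category.{v} C] [Preadditive C]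
    [Linear k C] {U : ObjectProperty C} {X : U.FullSubcategory} {Y : C} (e : X.obj ≅ Y) :
    Nonempty (End X ≃ₐ[k] End Y) :=
  ⟨AlgEquiv.ofLinearEquiv
    { toFun f := e.inv ≫ f.hom ≫ e.hom
      invFun g := U.fullyFaithfulι.preimage (e.hom ≫ g ≫ e.inv)
      map_add' f g := by
        change e.inv ≫ (f.hom + g.hom) ≫ e.hom = _
        rw [Preadditive.add_comp, Preadditive.comp_add]
      map_smul' r f := by
        change e.inv ≫ (r • f.hom) ≫ e.hom = _
        rw [Linear.smul_comp, Linear.comp_smul]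
        rfl
      left_inv f := U.ι.map_injective (by
        rw [U.fullyFaithfulι.map_preimage]
        simp)
      right_inv g := by
        change e.inv ≫ U.ι.map (U.fullyFaithfulι.preimage (e.hom ≫ g ≫ e.inv)) ≫ e.hom = g
        rw [U.fullyFaithfulι.map_preimage]
        simp }
    (by
      change e.inv ≫ 𝟙 X.obj ≫ e.hom = 𝟙 Y
      simp)
    (fun f g => by
      change e.inv ≫ (g.hom ≫ f.hom) ≫ e.hom = (e.inv ≫ g.hom ≫ e.hom) ≫ e.inv ≫ f.hom ≫ e.hom
      simp)⟩

end NCSpace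

/-! ### The proposition. -/

open NCSpace

theorem mainTheorem8 {k : Type*} [CommRing k]
    {C : Type u} [Category.{v} C] [Abelian C] [Linear k C] [IsGrothendieckAbelian.{v} C]
    (hX : NCSpace.IsIntegral C) (E : C) (hE : NCSpace.IsBigInjective E)
    (W : ObjectProperty C) (hW : NCSpace.IsWeaklyClosed W) (hWX : W ≠ ⊤)
    (hEW : ∀ (N : C) (i : N ⟶ E), Mono i → W N → IsZero N) :
    (NCSpace.IsWeaklyOpen (NCSpace.genericPoint E) ∧
      NCSpace.IsWeaklyOpen (NCSpace.complement W) ∧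
      NCSpace.genericPoint E ≤ NCSpace.complement W ∧
      NCSpace.weakClosure (NCSpace.complement W) = ⊤) ∧
    (NCSpace.IsIntegral (NCSpace.complement W).FullSubcategory ∧
      ∀ E' : (NCSpace.complement W).FullSubcategory, NCSpace.IsBigInjective E' →
        Nonempty (End E' ≃ₐ[k] End E)) := by
  have := hE.injective
  have hle : genericPoint E ≤ complement W :=
    quotientSubspace_antitone (localizingClosure_le_torsion hW hEW)
  have hEU : complement W E := hle _ (genericPoint_self E)
  have hopen : IsWeaklyOpen (complement W) :=
    isWeaklyOpen_quotientSubspace (isLocalizing_localizingClosure W)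
  have hopen' := hopen
  obtain ⟨F, adj, _, _⟩ := hopen'
  have hE₀ := hE.of_reflective adj hEU
  refine ⟨⟨isWeaklyOpen_quotientSubspace (isLocalizing_torsion E), hopen, hle,
    weakClosure_eq_top hE hEU⟩, ⟨isGrothendieck_of_reflective adj,
    isLocallyNoetherian_of_reflective adj hX.isLocallyNoetherian, _, hE₀⟩, fun E' hE' => ?_⟩
  obtain ⟨e⟩ := hE'.nonempty_iso hE₀
  exact nonempty_end_algEquiv ((complement W).ι.mapIso e)
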